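/- For real $x$ let $$C(x)=\int_0^x\cos\Big(\frac{\pi t^2}{2}\Big)\,dt,\qquad S(x)=\int_0^x\sin\Big(\frac{\pi t^2}{2}\Big)\,dt,\qquad G(x)=C(x)+\mathrm{i}\,S(x).$$ For $N\ge 0$ put $A_N=\sqrt{N+1/2}$ and define $$T_N(x)=\sum_{k=0}^{N}\frac{(\mathrm{i}\pi)^k x^{2k+1}}{2^k(2k+1)\,k!},$$ $$G_N(x)=\frac{1+\mathrm{i}}{2}-\frac{1+\mathrm{i}}{\exp\left((1-\mathrm{i})\pi A_N x\right)+1}-\frac{2\mathrm{i}x\exp(\mathrm{i}\pi x^2/2)}{\pi A_N}\sum_{k=1}^{N}\frac{\exp\left(-\pi(k-1/2)^2A_N^{-2}\right)}{x^2+2\mathrm{i}(k-1/2)^2A_N^{-2}},$$ and, for $x>0$, $$Q_N(x)=\frac{1+\mathrm{i}}{2}+\exp\Big(\frac{\mathrm{i}\pi x^2}{2}\Big)\sum_{k=0}^{N}\frac{(2k-1)!!\,(-\mathrm{i})^{k+1}}{\pi^{k+1}x^{2k+1}},\qquad (-1)!!=1.$$ Define the piecewise approximation $$\tilde G(x)=\begin{cases}T_{14}(x),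 & 0\le x\le 0.688,\\ G_{12}(x), & 0.688<x<6.725,\\ Q_{12}(x), & x\ge 6.725,\end{cases}$$ and $\tilde G(x)=-\tilde G(-x)$ for $x<0$. Then $$|G(x)-\tilde G(x)|<2^{-52}\qquad\text{for all } x\in\mathbb R.$$ -/

import Mathlib

noncomputable section

namespace Fresnel

/-- The Fresnel cosine integral `C(x) = ∫₀ˣ cos(π t² / 2) dt`. -/
def C (x : ℝ) : ℝ := ∫ t in (0 : ℝ)..x, Real.cos (Real.pi * t ^ 2 / 2)

/-- The Fresnel sine integral `S(x) = ∫₀ˣ sin(π t² / 2) dt`. -/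
def S (x : ℝ) : ℝ := ∫ t in (0 : ℝ)..x, Real.sin (Real.pi * t ^ 2 / 2)

/-- `G(x) = C(x) + i S(x)`. -/
def G (x : ℝ) : ℂ := (C x : ℂ) + Complex.I * (S x : ℂ)

/-- The truncated Taylor series
`T_N(x) = ∑_{k=0}^N (iπ)^k x^(2k+1) / (2^k (2k+1) k!)`. -/
def T (N : ℕ) (x : ℝ) : ℂ :=
  ∑ k ∈ Finset.range (N + 1),
    (Complex.I * (Real.pi : ℂ)) ^ k * (x : ℂ) ^ (2 * k + 1) /
      ((2 : ℂ) ^ k * (2 * (k : ℂ) + 1) * (Nat.factorial k : ℂ))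

/-- The constant `A_N = √(N + 1/2)`. -/
def A (N : ℕ) : ℝ := Real.sqrt ((N : ℝ) + 1 / 2)

/-- The modified trapezoid rule
`G_N(x) = (1+i)/2 - (1+i) / (exp((1-i) π A_N x) + 1)
  - (2 i x exp(iπx²/2) / (π A_N)) ∑_{k=1}^N exp(-π (k-1/2)² / A_N²) / (x² + 2i (k-1/2)² / A_N²)`. -/
def trapezoid (N : ℕ) (x : ℝ) : ℂ :=
  (1 + Complex.I) / 2
    - (1 + Complex.I) /
        (Complex.exp ((1 - Complex.I) * (Real.pi : ℂ) * (A N : ℂ) * (x : ℂ)) + 1)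
    - 2 * Complex.I * (x : ℂ) * Complex.exp (Complex.I * (Real.pi : ℂ) * (x : ℂ) ^ 2 / 2) /
        ((Real.pi : ℂ) * (A N : ℂ)) *
      ∑ k ∈ Finset.Icc 1 N,
        Complex.exp (-(Real.pi : ℂ) * ((k : ℂ) - 1 / 2) ^ 2 / (A N : ℂ) ^ 2) /
          ((x : ℂ) ^ 2 + Complex.I * 2 * ((k : ℂ) - 1 / 2) ^ 2 / (A N : ℂ) ^ 2)

/-- The truncated asymptotic expansion
`Q_N(x) = (1+i)/2 + exp(iπx²/2) ∑_{k=0}^N (2k-1)!! (-i)^(k+1) / (π^(k+1) x^(2k+1))`.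
For `k = 0` the truncated subtraction gives `0‼ = 1`, the usual value of `(-1)!!`. -/
def Q (N : ℕ) (x : ℝ) : ℂ :=
  (1 + Complex.I) / 2
    + Complex.exp (Complex.I * (Real.pi : ℂ) * (x : ℂ) ^ 2 / 2) *
      ∑ k ∈ Finset.range (N + 1),
        (Nat.doubleFactorial (2 * k - 1) : ℂ) * (-Complex.I) ^ (k + 1) /
          ((Real.pi : ℂ) ^ (k + 1) * (x : ℂ) ^ (2 * k + 1))

/-- The piecewise approximation on `[0, ∞)`: `T_14` on `[0, 0.688]`, `G_12` on `(0.688, 6.725)`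
and `Q_12` on `[6.725, ∞)`. (Only used for nonnegative arguments.) -/
def approxNonneg (x : ℝ) : ℂ :=
  if x ≤ 0.688 then T 14 x
  else if x < 6.725 then trapezoid 12 x
  else Q 12 x

/-- The approximation `G̃` on the real line: the piecewise approximation on `[0, ∞)`, extended to
negative arguments as an odd function. -/
def Gtilde (x : ℝ) : ℂ :=
  if 0 ≤ x then approxNonneg x else -approxNonneg (-x)

end Fresnel

end

open Filter Topology

namespace Fresnel

/-! The middle range rests on G(x) = x ∫₀¹ exp(iπx²s²/2) ds. By Jacobi's transformation, (2s/a) ∑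
exp(-π(n+1/2)²s²/a²) differs from 1 by O(exp(-πa²)), uniformly for 0 < s ≤ 1. Inserting this series
into the integral and integrating termwise leaves elementary integrals (e^z - 1)/z: the e^z parts
form the Gaussian sum of the trapezoid rule, and the -1 parts add up, by the partial fractions of
the tangent, to its closed-form part (`norm_G_sub_trapezoid_infinite_le`). With a² = N + 1/2 the
discarded tail is of order exp(-π(N+1/2)) too.

The same estimate with a = x yields G(x) → (1+i)/2 at infinity. The derivative of `Q N - G`
telescopes to a single term; integrating it from x to infinity gives `norm_Q_sub_G_le`, and passing
from N to N + 1 gives `norm_G_sub_Q_le`. Near 0 the Taylor remainder of the exponential is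
integrated (`norm_G_sub_T_le`). In each range the bound is monotone in x, so one rational evaluation
at the breakpoint suffices. -/

/-! ### Theta sums over the half-integers -/

lemma summable_exp_neg_half_sq {c : ℝ} (hc : 0 < c) :
    Summable fun n : ℕ => Real.exp (-Real.pi * ((n : ℝ) + 1 / 2) ^ 2 / c) := by
  have hr : -Real.pi / c < 0 := div_neg_of_neg_of_pos (by linarith [Real.pi_pos]) hc
  refine Summable.of_nonneg_of_le (fun n => (Real.exp_pos _).le) (fun n => ?_)
    (Real.summable_exp_nat_mul_iff.2 hr)
  apply Real.exp_le_exp.2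
  have h1 : (n : ℝ) ≤ ((n : ℝ) + 1 / 2) ^ 2 := by nlinarith [sq_nonneg ((n : ℝ))]
  have h2 := mul_le_mul_of_nonpos_right h1 hr.le
  calc -Real.pi * ((n : ℝ) + 1 / 2) ^ 2 / c = ((n : ℝ) + 1 / 2) ^ 2 * (-Real.pi / c) := by ring
    _ ≤ n * (-Real.pi / c) := h2

/-- The sum of a Gaussian over the half-integers, by Jacobi's theta transformation. -/
lemma abs_two_mul_tsum_exp_half_sq_sub_sqrt_le {c : ℝ} (hc : 0 < c) :
    |2 * ∑' n : ℕ, Real.exp (-Real.pi * ((n : ℝ) + 1 / 2) ^ 2 / c) - √c| ≤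
      √c * (2 * (Real.exp (-Real.pi * c) / (1 - Real.exp (-Real.pi * c)))) := by
  set q := Real.exp (-Real.pi * c) with hq
  have hq0 : 0 < q := Real.exp_pos _
  have hq1 : q < 1 := by
    rw [hq, Real.exp_lt_one_iff]; nlinarith [Real.pi_pos]
  set F : ℤ → ℂ := fun n => Complex.exp (-Real.pi / (c : ℂ) * (n + Complex.I * (-Complex.I / 2)) ^ 2)
  set f : ℤ → ℂ := fun n =>
    Complex.exp (-Real.pi * (c : ℂ) * n ^ 2 + 2 * Real.pi * (-Complex.I / 2) * n)
  -- The parameter -i/2 shifts the Gaussian by 1/2 on one side and gives the signs (-1)^n on the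
  -- other.
  have key := Complex.tsum_exp_neg_quadratic (a := (c : ℂ)) (by simpa using hc) (-Complex.I / 2)
  change ∑' n, f n = 1 / (c : ℂ) ^ (1 / 2 : ℂ) * ∑' n, F n at key
  have hsq : (c : ℂ) ^ (1 / 2 : ℂ) = ((√c : ℝ) : ℂ) := by
    rw [Real.sqrt_eq_rpow, Complex.ofReal_cpow hc.le]; norm_num
  have hs0 : 0 < √c := Real.sqrt_pos.2 hc
  have hI : Complex.I * (-Complex.I / 2) = 1 / 2 := by
    linear_combination (-1 / 2 : ℂ) * Complex.I_sq
  set S := ∑' n : ℕ, Real.exp (-Real.pi * ((n : ℝ) + 1 / 2) ^ 2 / c) with hS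
  have hSC : HasSum (fun n : ℕ => ((Real.exp (-Real.pi * ((n : ℝ) + 1 / 2) ^ 2 / c) : ℝ) : ℂ)) S :=
    Complex.hasSum_ofReal.2 (summable_exp_neg_half_sq hc).hasSum
  -- The indices n and -(n+1) give n + 1/2 and -(n + 1/2), so each half of ℤ contributes S.
  have hF : HasSum F ((S : ℂ) + S) := by
    refine HasSum.of_nat_of_neg_add_one ?_ ?_
    · refine hSC.congr_fun ?_
      intro n
      simp only [F, hI]; push_cast; congr 1; ring
    · refine hSC.congr_fun ?_
      intro n
      simp only [F, hI]; push_cast; congr 1; ring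
  have hfb : ∀ n : ℕ, ‖f (-((n : ℤ) + 1))‖ ≤ q * q ^ n ∧ ‖f ((n : ℤ) + 1)‖ ≤ q * q ^ n := by
    intro n
    have e : q * q ^ n = Real.exp (-Real.pi * c * (n + 1)) := by
      rw [hq, ← Real.exp_nat_mul, ← Real.exp_add]; congr 1; ring
    have hpc : 0 < Real.pi * c := mul_pos Real.pi_pos hc
    have h2 : ((n : ℝ) + 1) ≤ (n + 1) ^ 2 := by nlinarith [(Nat.cast_nonneg n : (0 : ℝ) ≤ n)]
    have hre : ∀ m : ℤ, ‖f m‖ = Real.exp (-Real.pi * c * (m : ℝ) ^ 2) := by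
      intro m
      simp only [f]
      rw [Complex.norm_exp]
      congr 1
      have : (-Real.pi * (c : ℂ) * m ^ 2 + 2 * Real.pi * (-Complex.I / 2) * m : ℂ) =
        ((-Real.pi * c * (m : ℝ) ^ 2 : ℝ) : ℂ) + ((-Real.pi * m : ℝ) : ℂ) * Complex.I := by
        push_cast; ring
      rw [this, Complex.add_re, Complex.ofReal_re, Complex.re_ofReal_mul, Complex.I_re]; simp
    rw [hre, hre, e]
    constructor <;> apply Real.exp_le_exp.2 <;> push_cast <;> nlinarith
  have hgs : HasSum (fun n : ℕ => q * q ^ n) (q * (1 - q)⁻¹) :=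
    (hasSum_geometric_of_lt_one hq0.le hq1).mul_left q
  have hs1 : Summable fun n : ℕ => f (-((n : ℤ) + 1)) :=
    Summable.of_norm_bounded hgs.summable fun n => (hfb n).1
  have hs2 : Summable fun n : ℕ => f ((n : ℤ) + 1) :=
    Summable.of_norm_bounded hgs.summable fun n => (hfb n).2
  have hb1 : ‖∑' n : ℕ, f (-((n : ℤ) + 1))‖ ≤ q * (1 - q)⁻¹ :=
    tsum_of_norm_bounded hgs fun n => (hfb n).1
  have hb2 : ‖∑' n : ℕ, f ((n : ℤ) + 1)‖ ≤ q * (1 - q)⁻¹ :=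
    tsum_of_norm_bounded hgs fun n => (hfb n).2
  have hs3 : Summable fun n : ℕ => f (n : ℤ) := by
    rw [← summable_nat_add_iff 1]; simpa using hs2
  have hsplit : ∑' n, f n = 1 + ∑' n : ℕ, f ((n : ℤ) + 1) + ∑' n : ℕ, f (-((n : ℤ) + 1)) := by
    rw [tsum_of_nat_of_neg_add_one hs3 hs1, hs3.tsum_eq_zero_add]
    simp [f]
  rw [hF.tsum_eq, hsplit, hsq] at key
  have hne : ((√c : ℝ) : ℂ) ≠ 0 := by exact_mod_cast hs0.ne'
  have h3 : ((2 * S - √c : ℝ) : ℂ) =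
      (√c : ℝ) * (∑' n : ℕ, f ((n : ℤ) + 1) + ∑' n : ℕ, f (-((n : ℤ) + 1))) := by
    field_simp at key
    push_cast
    linear_combination -key
  rw [← Real.norm_eq_abs, ← Complex.norm_real, h3, norm_mul, Complex.norm_real, Real.norm_eq_abs,
    abs_of_pos hs0]
  refine mul_le_mul_of_nonneg_left ((norm_add_le _ _).trans ?_) hs0.le
  rw [div_eq_mul_inv]; linarith

/-! ### Partial fractions of the tangent -/

/-- The partial fraction expansion of the hyperbolic tangent along the diagonal. -/
lemma hasSum_inv_sq_add_half_sq {a x : ℝ} (ha : 0 < a) (hx : 0 < x) :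
    HasSum (fun n : ℕ => 2 * Complex.I * x / (Real.pi * a) *
        (1 / ((x : ℂ) ^ 2 + Complex.I * 2 * ((n : ℂ) + 1 / 2) ^ 2 / (a : ℂ) ^ 2)))
      ((1 + Complex.I) / 2
        - (1 + Complex.I) / (Complex.exp ((1 - Complex.I) * Real.pi * a * x) + 1)) := by
  set w : ℂ := x * a * (1 + Complex.I) / 2 with hw
  have hI := Complex.I_sq
  have haC : (a : ℂ) ≠ 0 := by exact_mod_cast ha.ne'
  have hxC : (x : ℂ) ≠ 0 := by exact_mod_cast hx.ne'
  have hpC : (Real.pi : ℂ) ≠ 0 := by exact_mod_cast Real.pi_ne_zero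
  have hxa : 0 < x * a := mul_pos hx ha
  have him : w.im = x * a / 2 := by
    rw [hw, show (x * a * (1 + Complex.I) / 2 : ℂ) =
      ((x * a / 2 : ℝ) : ℂ) + ((x * a / 2 : ℝ) : ℂ) * Complex.I by push_cast; ring]
    simp
  have hnot : ∀ z : ℂ, 0 < z.im → z ∈ Complex.integerComplement := by
    rintro z hz ⟨m, rfl⟩
    simp at hz
  have hwc := hnot w (by rw [him]; linarith)
  have h2wc := hnot (2 * w) (by simp [him]; linarith)
  have hcot : ∀ z ∈ Complex.integerComplement, HasSum (fun n : ℕ => cotTerm z n)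
      (Real.pi * Complex.cot (Real.pi * z) - 1 / z) := fun z hz => by
    rw [cot_series_rep' hz]; exact (summable_cotTerm hz).hasSum
  have hw1 := hcot w hwc
  have hw2 := hcot (2 * w) h2wc
  -- `cotTerm z n` has poles at ±(n+1). Odd indices thus carry the even integers, and at 2w they
  -- reproduce half the series at w; the even indices are left with the odd integers.
  have hodd : HasSum (fun m : ℕ => cotTerm (2 * w) (2 * m + 1))
      ((Real.pi * Complex.cot (Real.pi * w) - 1 / w) / 2) := by
    refine (hw1.div_const 2).congr_fun fun m => ?_
    have e1 : 2 * w - (((2 * m + 1 : ℕ) : ℂ) + 1) = 2 * (w - (m + 1)) := by push_cast; ring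
    have e2 : 2 * w + (((2 * m + 1 : ℕ) : ℂ) + 1) = 2 * (w + (m + 1)) := by push_cast; ring
    rw [cotTerm, cotTerm, e1, e2, one_div, one_div, mul_inv, mul_inv]; ring
  have hev : HasSum (fun m : ℕ => cotTerm (2 * w) (2 * m))
      (Real.pi * Complex.cot (Real.pi * (2 * w)) - 1 / (2 * w) -
        (Real.pi * Complex.cot (Real.pi * w) - 1 / w) / 2) := by
    have hs : Summable fun m : ℕ => cotTerm (2 * w) (2 * m) :=
      (summable_cotTerm h2wc).comp_injective (mul_right_injective₀ two_ne_zero)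
    have h := (hs.hasSum.even_add_odd hodd).unique hw2
    rw [← h, add_sub_cancel_right]
    exact hs.hasSum
  set e := Complex.exp (2 * Real.pi * Complex.I * w) with he
  have hnorm : ‖e‖ < 1 := by
    rw [he, Complex.norm_exp, Real.exp_lt_one_iff]
    have : (2 * Real.pi * Complex.I * w).re = -(2 * Real.pi * w.im) := by
      simp [mul_assoc]
    rw [this, him]
    have := mul_pos Real.pi_pos hxa
    linarith
  have h1e : 1 - e ≠ 0 := fun h => by
    rw [← sub_eq_zero.1 h] at hnorm; simp at hnorm
  have h1e' : 1 + e ≠ 0 := fun h => by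
    rw [show e = -1 by linear_combination h] at hnorm; simp at hnorm
  have hw0 : w ≠ 0 := Complex.integerComplement.ne_zero hwc
  have hE : Complex.exp ((1 - Complex.I) * Real.pi * a * x) = e⁻¹ := by
    rw [he, ← Complex.exp_neg]; congr 1; rw [hw]
    linear_combination (Real.pi * a * x : ℂ) * hI
  have he0 : e ≠ 0 := Complex.exp_ne_zero _
  have he2 : Complex.exp (2 * Real.pi * Complex.I * (2 * w)) = e ^ 2 := by
    rw [he, ← Complex.exp_nat_mul]; congr 1; push_cast; ring
  have hI0 := Complex.I_ne_zero
  have h1e2 : 1 - e ^ 2 ≠ 0 := by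
    rw [show 1 - e ^ 2 = (1 - e) * (1 + e) by ring]; exact mul_ne_zero h1e h1e'
  -- This is cot 2πw - (cot πw)/2 = -(tan πw)/2, written in e = exp(2πiw).
  have hcc : (e ^ 2 + 1) / (Complex.I * (1 - e ^ 2)) - (e + 1) / (Complex.I * (1 - e)) / 2 =
      -Complex.I * ((1 - e) / (2 * (1 + e))) := by
    rw [div_mul_eq_div_div_swap, div_mul_eq_div_div_swap, Complex.div_I, Complex.div_I,
      show 1 - e ^ 2 = (1 - e) * (1 + e) by ring]
    field_simp
    ring
  have hlim : (1 + Complex.I) / 2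
        - (1 + Complex.I) / (Complex.exp ((1 - Complex.I) * Real.pi * a * x) + 1) =
      -(1 - Complex.I) / Real.pi * (Real.pi * Complex.cot (Real.pi * (2 * w)) - 1 / (2 * w) -
        (Real.pi * Complex.cot (Real.pi * w) - 1 / w) / 2) := by
    rw [Complex.cot_pi_eq_exp_ratio, Complex.cot_pi_eq_exp_ratio, he2, ← he, hE]
    have e1 : e⁻¹ + 1 = (1 + e) / e := by field_simp
    have e2 : (1 + Complex.I) / 2 - (1 + Complex.I) / (e⁻¹ + 1) =
        (1 + Complex.I) * ((1 - e) / (2 * (1 + e))) := by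
      rw [e1]; field_simp; ring
    have e3 : (Real.pi * ((e ^ 2 + 1) / (Complex.I * (1 - e ^ 2))) - 1 / (2 * w) -
        (Real.pi * ((e + 1) / (Complex.I * (1 - e))) - 1 / w) / 2) =
        Real.pi * (-Complex.I * ((1 - e) / (2 * (1 + e)))) := by
      rw [← hcc]; ring_nf
    rw [e2, e3, div_mul_eq_mul_div, eq_div_iff hpC]
    linear_combination ((1 - e) / (2 * (1 + e)) * Real.pi : ℂ) * hI
  rw [hlim]
  refine (hev.mul_left _).congr_fun fun m => ?_
  have hm1 : 2 * w + (((2 * m : ℕ) : ℂ) + 1) ≠ 0 := by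
    have := Complex.integerComplement_add_ne_zero h2wc (2 * m + 1)
    push_cast at this ⊢; exact this
  have hm2 : 2 * w - (((2 * m : ℕ) : ℂ) + 1) ≠ 0 := by
    have := Complex.integerComplement_add_ne_zero h2wc (-(2 * m + 1))
    push_cast at this ⊢; rw [sub_eq_add_neg]; exact this
  -- Since (2w)² = 2i x²a², the denominator factors over the poles ±(2m+1).
  have hZ : (x : ℂ) ^ 2 + Complex.I * 2 * ((m : ℂ) + 1 / 2) ^ 2 / (a : ℂ) ^ 2 =
      -(Complex.I / (2 * a ^ 2)) *
        ((2 * w + (((2 * m : ℕ) : ℂ) + 1)) * (2 * w - (((2 * m : ℕ) : ℂ) + 1))) := by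
    rw [hw]; push_cast; field_simp
    linear_combination (2 * x ^ 2 * a ^ 2 + x ^ 2 * a ^ 2 * Complex.I : ℂ) * hI
  have hsum : 2 * w + (((2 * m : ℕ) : ℂ) + 1) + (2 * w - (((2 * m : ℕ) : ℂ) + 1)) =
      2 * (x * a * (1 + Complex.I)) := by rw [hw]; ring
  rw [hZ, cotTerm, one_div_add_one_div hm2 hm1, add_comm (2 * w - _), hsum]
  generalize 2 * w + (((2 * m : ℕ) : ℂ) + 1) = P at *
  generalize 2 * w - (((2 * m : ℕ) : ℂ) + 1) = M at *
  field_simp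
  linear_combination -hI

/-! ### The trapezoid rule with infinitely many nodes -/

lemma G_eq_integral_exp (x : ℝ) :
    G x = ∫ t in (0 : ℝ)..x, Complex.exp (Complex.I * Real.pi * (t : ℂ) ^ 2 / 2) := by
  have h : ∀ t : ℝ, Complex.exp (Complex.I * Real.pi * (t : ℂ) ^ 2 / 2) =
      ((Real.cos (Real.pi * t ^ 2 / 2) : ℝ) : ℂ) +
        Complex.I * ((Real.sin (Real.pi * t ^ 2 / 2) : ℝ) : ℂ) := fun t => by
    rw [show (Complex.I * Real.pi * (t : ℂ) ^ 2 / 2) = ((Real.pi * t ^ 2 / 2 : ℝ) : ℂ) * Complex.I by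
      push_cast; ring, Complex.exp_mul_I]
    push_cast; ring
  simp_rw [h]
  rw [intervalIntegral.integral_add, intervalIntegral.integral_const_mul,
    intervalIntegral.integral_ofReal, intervalIntegral.integral_ofReal]
  · rfl
  all_goals exact Continuous.intervalIntegrable (by fun_prop) _ _

lemma norm_exp_I_pi_sq (t : ℝ) : ‖Complex.exp (Complex.I * Real.pi * (t : ℂ) ^ 2 / 2)‖ = 1 := by
  rw [show (Complex.I * Real.pi * (t : ℂ) ^ 2 / 2) = ((Real.pi * t ^ 2 / 2 : ℝ) : ℂ) * Complex.I by
      push_cast; ring, Complex.norm_exp_ofReal_mul_I]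

lemma G_neg (x : ℝ) : G (-x) = -G x := by
  have h := intervalIntegral.integral_comp_neg (a := 0) (b := x)
    (fun t : ℝ => Complex.exp (Complex.I * Real.pi * (t : ℂ) ^ 2 / 2))
  rw [G_eq_integral_exp, G_eq_integral_exp, intervalIntegral.integral_symm, ← neg_zero, ← h]
  simp

/-- The denominator of the terms of the trapezoid rule. -/
noncomputable def den (a x : ℝ) (n : ℕ) : ℂ :=
  (x : ℂ) ^ 2 + Complex.I * 2 * ((n : ℂ) + 1 / 2) ^ 2 / (a : ℂ) ^ 2

lemma den_eq (a x : ℝ) (n : ℕ) :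
    den a x n = ((x ^ 2 : ℝ) : ℂ) + ((2 * ((n : ℝ) + 1 / 2) ^ 2 / a ^ 2 : ℝ) : ℂ) * Complex.I := by
  rw [den]; push_cast; ring

lemma sq_le_norm_den (a x : ℝ) (n : ℕ) : x ^ 2 ≤ ‖den a x n‖ := by
  have h : (den a x n).re = x ^ 2 := by rw [den_eq, Complex.add_re, Complex.ofReal_re]; simp [-Complex.ofReal_pow]
  rw [← h]
  exact (le_abs_self _).trans (Complex.abs_re_le_norm _)

lemma two_mul_half_sq_div_le_norm_den (a x : ℝ) (n : ℕ) :
    2 * ((n : ℝ) + 1 / 2) ^ 2 / a ^ 2 ≤ ‖den a x n‖ := by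
  have h : (den a x n).im = 2 * ((n : ℝ) + 1 / 2) ^ 2 / a ^ 2 := by
    rw [den_eq, Complex.add_im, Complex.im_ofReal_mul, Complex.ofReal_im]; simp
  rw [← h]
  exact (le_abs_self _).trans (Complex.abs_im_le_norm _)

lemma den_ne_zero (a : ℝ) {x : ℝ} (hx : 0 < x) (n : ℕ) : den a x n ≠ 0 := fun h => by
  have := sq_le_norm_den a x n
  rw [h, norm_zero] at this
  exact absurd this (not_le.2 (by positivity))

/-- A single Gaussian term of the trapezoid rule. -/
noncomputable def gaussTerm (a x : ℝ) (n : ℕ) : ℂ :=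
  Complex.exp (-(Real.pi : ℂ) * ((n : ℂ) + 1 / 2) ^ 2 / (a : ℂ) ^ 2) / den a x n

lemma norm_gaussTerm (a x : ℝ) (n : ℕ) :
    ‖gaussTerm a x n‖ = Real.exp (-Real.pi * ((n : ℝ) + 1 / 2) ^ 2 / a ^ 2) / ‖den a x n‖ := by
  rw [gaussTerm, norm_div, show (-(Real.pi : ℂ) * ((n : ℂ) + 1 / 2) ^ 2 / (a : ℂ) ^ 2) =
    ((-Real.pi * ((n : ℝ) + 1 / 2) ^ 2 / a ^ 2 : ℝ) : ℂ) by push_cast; ring, Complex.norm_exp_ofReal]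

lemma summable_gaussTerm {a x : ℝ} (ha : 0 < a) (hx : 0 < x) : Summable (gaussTerm a x) := by
  refine Summable.of_norm_bounded
    ((summable_exp_neg_half_sq (c := a ^ 2) (by positivity)).mul_right (x ^ 2)⁻¹) fun n => ?_
  rw [norm_gaussTerm, div_eq_mul_inv]
  have := sq_le_norm_den a x n
  gcongr

/-- Substitute u = s². The factor s carried by the theta series is what makes each term elementary.
-/
lemma integral_two_mul_exp_sq {z : ℂ} (hz : z ≠ 0) :
    ∫ s in (0 : ℝ)..1, 2 * (s : ℂ) * Complex.exp ((s : ℂ) ^ 2 * z) = (Complex.exp z - 1) / z := by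
  have hd : ∀ s : ℝ, HasDerivAt (fun s : ℝ => Complex.exp ((s : ℂ) ^ 2 * z) / z)
      (2 * (s : ℂ) * Complex.exp ((s : ℂ) ^ 2 * z)) s := fun s => by
    have h : HasDerivAt (fun s : ℂ => Complex.exp (s ^ 2 * z) / z)
      (2 * (s : ℂ) * Complex.exp ((s : ℂ) ^ 2 * z)) s := by
      have h1 := ((((hasDerivAt_id (s : ℂ)).pow 2).mul_const z).cexp).div_const z
      refine h1.congr_deriv ?_
      simp
      field_simp
    exact h.comp_ofReal
  rw [intervalIntegral.integral_eq_sub_of_hasDerivAt (fun s _ => hd s)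
    (Continuous.intervalIntegrable (by fun_prop) _ _)]
  simp [sub_div]

/-- The rescaled theta function `(2 s / a) ∑ exp (-π (n + 1/2)² s² / a²)`, which is close to `1`. -/
noncomputable def thetaHalf (a s : ℝ) : ℝ :=
  s / a * (2 * ∑' n : ℕ, Real.exp (-Real.pi * ((n : ℝ) + 1 / 2) ^ 2 / (a ^ 2 / s ^ 2)))

/-- Apply the theta bound with c = a²/s²: the prefactor s/a cancels √c, and c ≥ a² for s ≤ 1 makes
the bound uniform in s. -/
lemma abs_thetaHalf_sub_one_le {a s : ℝ} (ha : 0 < a) (hs : s ∈ Set.Ioc (0 : ℝ) 1) :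
    |thetaHalf a s - 1| ≤
      2 * (Real.exp (-Real.pi * a ^ 2) / (1 - Real.exp (-Real.pi * a ^ 2))) := by
  obtain ⟨hs0, hs1⟩ := hs
  have hc : 0 < a ^ 2 / s ^ 2 := by positivity
  have hsq : √(a ^ 2 / s ^ 2) = a / s := by
    rw [← div_pow, Real.sqrt_sq (by positivity)]
  have h := abs_two_mul_tsum_exp_half_sq_sub_sqrt_le hc
  rw [hsq] at h
  have hle : a ^ 2 ≤ a ^ 2 / s ^ 2 := by
    rw [le_div_iff₀ (by positivity)]
    exact mul_le_of_le_one_right (by positivity) (pow_le_one₀ hs0.le hs1)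
  have hq : Real.exp (-Real.pi * (a ^ 2 / s ^ 2)) ≤ Real.exp (-Real.pi * a ^ 2) := by
    apply Real.exp_le_exp.2; nlinarith [Real.pi_pos]
  have hq1 : Real.exp (-Real.pi * a ^ 2) < 1 := by
    rw [Real.exp_lt_one_iff]; nlinarith [mul_pos Real.pi_pos (pow_pos ha 2)]
  have e : thetaHalf a s - 1 = s / a * (2 * ∑' n : ℕ,
      Real.exp (-Real.pi * ((n : ℝ) + 1 / 2) ^ 2 / (a ^ 2 / s ^ 2)) - a / s) := by
    rw [thetaHalf]; field_simp
  rw [e, abs_mul, abs_of_pos (by positivity : 0 < s / a)]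
  refine (mul_le_mul_of_nonneg_left h (by positivity)).trans ?_
  rw [← mul_assoc, show s / a * (a / s) = 1 by field_simp, one_mul]
  have : 0 < 1 - Real.exp (-Real.pi * a ^ 2) := by linarith
  gcongr

/-- Because i·i = -1, the imaginary part of `den` becomes a decaying Gaussian, while its real part
gives the Fresnel oscillation. -/
lemma exp_sq_mul_den (a x s : ℝ) (n : ℕ) :
    Complex.exp ((s : ℂ) ^ 2 * (Complex.I * Real.pi / 2 * den a x n)) =
      Complex.exp (Complex.I * Real.pi * ((x * s : ℝ) : ℂ) ^ 2 / 2) *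
        ((Real.exp (-Real.pi * ((n : ℝ) + 1 / 2) ^ 2 * s ^ 2 / a ^ 2) : ℝ) : ℂ) := by
  rw [Complex.ofReal_exp, ← Complex.exp_add]
  congr 1
  rw [den]; push_cast
  linear_combination (Real.pi * s ^ 2 * (n + 1 / 2) ^ 2 / a ^ 2 : ℂ) * Complex.I_sq

/-- The discretization error of the modified trapezoid rule with infinitely many nodes. -/
lemma norm_G_sub_trapezoid_infinite_le {a x : ℝ} (ha : 0 < a) (hx : 0 < x) :
    ‖G x - ((1 + Complex.I) / 2
        - (1 + Complex.I) / (Complex.exp ((1 - Complex.I) * Real.pi * a * x) + 1)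
        - 2 * Complex.I * x * Complex.exp (Complex.I * Real.pi * (x : ℂ) ^ 2 / 2) / (Real.pi * a) *
          ∑' n, gaussTerm a x n)‖ ≤
      x * (2 * (Real.exp (-Real.pi * a ^ 2) / (1 - Real.exp (-Real.pi * a ^ 2)))) := by
  set δ := 2 * (Real.exp (-Real.pi * a ^ 2) / (1 - Real.exp (-Real.pi * a ^ 2))) with hδ
  have haC : (a : ℂ) ≠ 0 := by exact_mod_cast ha.ne'
  have hpC : (Real.pi : ℂ) ≠ 0 := by exact_mod_cast Real.pi_ne_zero
  set K : ℕ → ℝ → ℂ := fun n s =>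
    1 / a * (2 * (s : ℂ) * Complex.exp ((s : ℂ) ^ 2 * (Complex.I * Real.pi / 2 * den a x n))) with hK
  set E : ℝ → ℂ := fun s => Complex.exp (Complex.I * Real.pi * ((x * s : ℝ) : ℂ) ^ 2 / 2) with hE
  set r : ℕ → ℝ → ℝ := fun n s =>
    s / a * (2 * Real.exp (-Real.pi * ((n : ℝ) + 1 / 2) ^ 2 / (a ^ 2 / s ^ 2))) with hr
  have hKr : ∀ n s, K n s = E s * (r n s : ℝ) := fun n s => by
    simp only [hK, exp_sq_mul_den, hE, hr]
    have : -Real.pi * ((n : ℝ) + 1 / 2) ^ 2 * s ^ 2 / a ^ 2 =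
      -Real.pi * ((n : ℝ) + 1 / 2) ^ 2 / (a ^ 2 / s ^ 2) := by rw [div_div_eq_mul_div]
    rw [this]; push_cast; ring
  have hEn : ∀ s, ‖E s‖ = 1 := fun s => norm_exp_I_pi_sq _
  have hEc : Continuous E := by fun_prop
  have hKc : ∀ n, Continuous (K n) := fun n => by fun_prop
  have hrs : ∀ s ∈ Set.Ioc (0 : ℝ) 1, HasSum (fun n => r n s) (thetaHalf a s) := fun s hs =>
    (((summable_exp_neg_half_sq (c := a ^ 2 / s ^ 2)
      (div_pos (pow_pos ha 2) (pow_pos hs.1 2))).hasSum.mul_left 2).mul_left (s / a))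
  have hr0 : ∀ n, ∀ s ∈ Set.Ioc (0 : ℝ) 1, 0 ≤ r n s := fun n s hs => by
    have := hs.1
    positivity
  have hlim : ∀ s ∈ Set.Ioc (0 : ℝ) 1,
      Tendsto (fun M => ∑ n ∈ Finset.range M, K n s) atTop (𝓝 (E s * (thetaHalf a s : ℝ))) := by
    intro s hs
    simp_rw [hKr]
    exact ((Complex.hasSum_ofReal.2 (hrs s hs)).mul_left (E s)).tendsto_sum_nat
  have hae : ∀ᵐ s ∂MeasureTheory.volume.restrict (Set.Ioc (0 : ℝ) 1), s ∈ Set.Ioc (0 : ℝ) 1 :=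
    MeasureTheory.ae_restrict_mem measurableSet_Ioc
  have hmeas : MeasureTheory.AEStronglyMeasurable (fun s => E s * (thetaHalf a s : ℝ))
      (MeasureTheory.volume.restrict (Set.Ioc (0 : ℝ) 1)) :=
    aestronglyMeasurable_of_tendsto_ae atTop
      (fun M => (continuous_finsetSum (Finset.range M) fun n _ => hKc n).aestronglyMeasurable)
      (hae.mono fun s hs => by simpa using hlim s hs)
  have hth : ∀ s ∈ Set.Ioc (0 : ℝ) 1, |thetaHalf a s| ≤ 1 + δ := fun s hs => by
    have h1 := abs_thetaHalf_sub_one_le ha hs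
    have h2 := abs_add_le (thetaHalf a s - 1) 1
    rw [sub_add_cancel, abs_one] at h2
    linarith
  have hint : MeasureTheory.Integrable (fun s => E s * (thetaHalf a s : ℝ))
      (MeasureTheory.volume.restrict (Set.Ioc (0 : ℝ) 1)) := by
    refine MeasureTheory.Integrable.of_bound hmeas (1 + δ) (hae.mono fun s hs => ?_)
    rw [norm_mul, hEn, one_mul, Complex.norm_real]
    exact hth s hs
  -- The factor E has modulus 1 and the theta terms are nonnegative, so the constant 1 + δ dominates
  -- all partial sums.
  have hdct : Tendsto (fun M => ∫ s in Set.Ioc (0 : ℝ) 1, ∑ n ∈ Finset.range M, K n s) atTop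
      (𝓝 (∫ s in Set.Ioc (0 : ℝ) 1, E s * (thetaHalf a s : ℝ))) := by
    refine MeasureTheory.tendsto_integral_of_dominated_convergence (fun _ => 1 + δ)
      (fun M => (continuous_finsetSum (Finset.range M) fun n _ => hKc n).aestronglyMeasurable)
      (MeasureTheory.integrable_const _) (fun M => hae.mono fun s hs => ?_)
      (hae.mono fun s hs => hlim s hs)
    calc ‖∑ n ∈ Finset.range M, K n s‖ ≤ ∑ n ∈ Finset.range M, r n s := by
          refine norm_sum_le_of_le _ fun n _ => ?_
          rw [hKr, norm_mul, hEn, one_mul, Complex.norm_real, Real.norm_of_nonneg (hr0 n s hs)]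
      _ ≤ thetaHalf a s := sum_le_hasSum _ (fun n _ => hr0 n s hs) (hrs s hs)
      _ ≤ 1 + δ := (le_abs_self _).trans (hth s hs)
  -- The two summands are the -1 and the e^z of (e^z - 1)/z, with z = (iπ/2) `den a x n`.
  have hterm : ∀ n, (x : ℂ) * ∫ s in Set.Ioc (0 : ℝ) 1, K n s =
      2 * Complex.I * x / (Real.pi * a) * (1 / den a x n) -
        2 * Complex.I * x * Complex.exp (Complex.I * Real.pi * (x : ℂ) ^ 2 / 2) / (Real.pi * a) *
          gaussTerm a x n := by
    intro n
    have hd := den_ne_zero a hx n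
    have hz : Complex.I * Real.pi / 2 * den a x n ≠ 0 :=
      mul_ne_zero (div_ne_zero (mul_ne_zero Complex.I_ne_zero hpC) two_ne_zero) hd
    have he : Complex.exp (Complex.I * Real.pi / 2 * den a x n) =
        Complex.exp (Complex.I * Real.pi * (x : ℂ) ^ 2 / 2) *
        Complex.exp (-(Real.pi : ℂ) * ((n : ℂ) + 1 / 2) ^ 2 / (a : ℂ) ^ 2) := by
      have := exp_sq_mul_den a x 1 n
      push_cast at this
      simpa using this
    rw [← intervalIntegral.integral_of_le zero_le_one, intervalIntegral.integral_const_mul,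
      integral_two_mul_exp_sq hz, he, gaussTerm]
    have hI0 := Complex.I_ne_zero
    generalize Complex.exp (Complex.I * Real.pi * (x : ℂ) ^ 2 / 2) = E₁
    generalize Complex.exp (-(Real.pi : ℂ) * ((n : ℂ) + 1 / 2) ^ 2 / (a : ℂ) ^ 2) = E₂
    field_simp
    linear_combination (x * (E₁ * E₂ - 1) : ℂ) * Complex.I_sq
  have hsum : Tendsto (fun M => (x : ℂ) * ∫ s in Set.Ioc (0 : ℝ) 1, ∑ n ∈ Finset.range M, K n s) atTop
      (𝓝 ((1 + Complex.I) / 2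
        - (1 + Complex.I) / (Complex.exp ((1 - Complex.I) * Real.pi * a * x) + 1)
        - 2 * Complex.I * x * Complex.exp (Complex.I * Real.pi * (x : ℂ) ^ 2 / 2) / (Real.pi * a) *
          ∑' n, gaussTerm a x n)) := by
    have h := ((hasSum_inv_sq_add_half_sq ha hx).sub
      ((summable_gaussTerm ha hx).hasSum.mul_left (2 * Complex.I * x *
        Complex.exp (Complex.I * Real.pi * (x : ℂ) ^ 2 / 2) / (Real.pi * a)))).tendsto_sum_nat
    refine h.congr fun M => ?_
    rw [MeasureTheory.integral_finsetSum, Finset.mul_sum]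
    · exact Finset.sum_congr rfl fun n _ => (hterm n).symm
    · exact fun n _ => ((hKc n).integrableOn_Icc).mono_set Set.Ioc_subset_Icc_self
  have hG : G x = x * ∫ s in Set.Ioc (0 : ℝ) 1, E s := by
    have h := intervalIntegral.smul_integral_comp_mul_left (a := 0) (b := 1)
      (fun t : ℝ => Complex.exp (Complex.I * Real.pi * (t : ℂ) ^ 2 / 2)) x
    rw [mul_zero, mul_one] at h
    rw [G_eq_integral_exp, ← h, ← intervalIntegral.integral_of_le zero_le_one,
      Complex.real_smul]
  rw [← tendsto_nhds_unique (hdct.const_mul (x : ℂ)) hsum, hG, ← mul_sub,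
    ← MeasureTheory.integral_sub (hEc.integrableOn_Icc.mono_set Set.Ioc_subset_Icc_self) hint,
    norm_mul, Complex.norm_real, Real.norm_of_nonneg hx.le]
  refine mul_le_mul_of_nonneg_left ?_ hx.le
  refine (MeasureTheory.norm_setIntegral_le_of_norm_le_const (C := δ) (by simp) fun s hs => ?_).trans
    (by simp)
  rw [show E s - E s * (thetaHalf a s : ℝ) = E s * ((1 - thetaHalf a s : ℝ) : ℂ) by
    push_cast; ring, norm_mul, hEn, one_mul, Complex.norm_real, Real.norm_eq_abs, abs_sub_comm]
  exact abs_thetaHalf_sub_one_le ha hs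

/-! ### The limit of G at infinity -/

lemma exp_neg_div_one_sub_exp_neg_le {y : ℝ} (hy : 0 < y) :
    Real.exp (-y) / (1 - Real.exp (-y)) ≤ 1 / y := by
  have h1 : Real.exp (-y) < 1 := Real.exp_lt_one_iff.2 (by linarith)
  have h2 := Real.add_one_le_exp y
  have h3 : Real.exp (-y) * Real.exp y = 1 := by rw [← Real.exp_add]; simp
  rw [div_le_div_iff₀ (by linarith) hy]
  nlinarith [Real.exp_pos (-y)]

lemma norm_one_add_I_le : ‖(1 + Complex.I : ℂ)‖ ≤ 2 := by
  refine (norm_add_le _ _).trans ?_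
  rw [norm_one, Complex.norm_I]; norm_num

/-- Choosing a = x makes the discretization error, the exponential correction U and the Gaussian sum
V each at most 1/x. -/
lemma norm_G_sub_limit_le {x : ℝ} (hx : 1 ≤ x) : ‖G x - (1 + Complex.I) / 2‖ ≤ 3 / x := by
  have hx0 : 0 < x := by linarith
  have hpi := Real.pi_gt_three
  have hy : 0 < Real.pi * x ^ 2 := by positivity
  have hq := exp_neg_div_one_sub_exp_neg_le hy
  rw [← neg_mul] at hq
  have hq' : 1 / (Real.pi * x ^ 2) ≤ 1 / (3 * x ^ 2) := by gcongr
  have hmain := norm_G_sub_trapezoid_infinite_le hx0 hx0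
  set δ := Real.exp (-Real.pi * x ^ 2) / (1 - Real.exp (-Real.pi * x ^ 2)) with hδ
  have hδ' : δ ≤ 1 / (3 * x ^ 2) := hq.trans hq'
  set U := (1 + Complex.I) / (Complex.exp ((1 - Complex.I) * Real.pi * x * x) + 1) with hU
  set V := 2 * Complex.I * x * Complex.exp (Complex.I * Real.pi * (x : ℂ) ^ 2 / 2) / (Real.pi * x) *
          ∑' n, gaussTerm x x n with hV
  have hUn : ‖U‖ ≤ 1 / x := by
    have h1 : ‖Complex.exp ((1 - Complex.I) * Real.pi * x * x)‖ = Real.exp (Real.pi * x ^ 2) := by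
      rw [Complex.norm_exp]; congr 1
      rw [show (1 - Complex.I) * Real.pi * x * x = ((Real.pi * x ^ 2 : ℝ) : ℂ) +
        ((-(Real.pi * x ^ 2) : ℝ) : ℂ) * Complex.I by push_cast; ring, Complex.add_re,
        Complex.re_ofReal_mul, Complex.ofReal_re]
      simp
    have h2 := norm_sub_norm_le (Complex.exp ((1 - Complex.I) * Real.pi * x * x)) (-1)
    rw [sub_neg_eq_add, norm_neg, norm_one, h1] at h2
    have h3 := Real.add_one_le_exp (Real.pi * x ^ 2)
    have h4 : 2 * x ≤ Real.pi * x ^ 2 := by nlinarith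
    rw [hU, norm_div]
    calc _ ≤ 2 / (2 * x) := by
          have := norm_one_add_I_le
          gcongr
          linarith
      _ = 1 / x := by field_simp
  have hVn : ‖V‖ ≤ 1 / x := by
    have h1 := abs_two_mul_tsum_exp_half_sq_sub_sqrt_le (c := x ^ 2) (by positivity)
    rw [Real.sqrt_sq hx0.le, ← hδ] at h1
    have h2 := (abs_le.1 h1).2
    set S := ∑' n : ℕ, Real.exp (-Real.pi * ((n : ℝ) + 1 / 2) ^ 2 / x ^ 2)
    -- The theta bound gives 2S ≤ x + 2δx, and 2δ ≤ 2/3 because x ≥ 1.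
    have hS : S ≤ x := by
      have : x * (2 * δ) ≤ x * 1 := by
        apply mul_le_mul_of_nonneg_left _ hx0.le
        have : 1 / (3 * x ^ 2) ≤ 1 / (3 * 1 ^ 2) := by gcongr
        linarith
      linarith
    have h3 : ‖∑' n, gaussTerm x x n‖ ≤ S * (x ^ 2)⁻¹ := by
      refine tsum_of_norm_bounded ((summable_exp_neg_half_sq (c := x ^ 2)
        (by positivity)).hasSum.mul_right (x ^ 2)⁻¹) fun n => ?_
      rw [norm_gaussTerm, div_eq_mul_inv]
      have := sq_le_norm_den x x n
      gcongr
    rw [hV, norm_mul, norm_div, norm_mul, norm_exp_I_pi_sq, norm_mul, norm_mul, norm_mul,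
      Complex.norm_I, Complex.norm_real, Complex.norm_real, Real.norm_of_nonneg hx0.le,
      Real.norm_of_nonneg Real.pi_pos.le, Complex.norm_ofNat]
    calc 2 * 1 * x * 1 / (Real.pi * x) * ‖∑' n, gaussTerm x x n‖
        ≤ 2 * 1 * x * 1 / (2 * x) * (x * (x ^ 2)⁻¹) := by
          gcongr
          · linarith
          · exact h3.trans (by gcongr)
      _ = 1 / x := by field_simp
  have hW : x * (2 * δ) ≤ 1 / x := by
    calc x * (2 * δ) ≤ x * (2 * (1 / (3 * x ^ 2))) := by gcongr
      _ = (2 / 3) * (1 / x) := by field_simp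
      _ ≤ 1 / x := by have : 0 < 1 / x := by positivity
                      linarith
  have e : G x - (1 + Complex.I) / 2 = (G x - ((1 + Complex.I) / 2 - U - V)) - U - V := by ring
  rw [e]
  refine (norm_sub_le _ _).trans ((add_le_add (norm_sub_le _ _) le_rfl).trans ?_)
  have : 3 / x = 1 / x + 1 / x + 1 / x := by ring
  linarith

lemma tendsto_G : Tendsto G atTop (𝓝 ((1 + Complex.I) / 2)) := by
  rw [tendsto_iff_norm_sub_tendsto_zero]
  refine squeeze_zero' (Eventually.of_forall fun x => norm_nonneg _)
    ((eventually_ge_atTop 1).mono fun x hx => norm_G_sub_limit_le hx) ?_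
  exact tendsto_const_nhds.div_atTop tendsto_id

/-! ### The asymptotic expansion -/

lemma hasDerivAt_G (x : ℝ) :
    HasDerivAt G (Complex.exp (Complex.I * Real.pi * (x : ℂ) ^ 2 / 2)) x := by
  have h : G = fun x => ∫ t in (0 : ℝ)..x, Complex.exp (Complex.I * Real.pi * (t : ℂ) ^ 2 / 2) :=
    funext G_eq_integral_exp
  rw [h]
  exact (Continuous.integral_hasStrictDerivAt (by fun_prop) 0 x).hasDerivAt

/-- The coefficients of the asymptotic expansion. -/
noncomputable def coeff (k : ℕ) : ℂ :=
  (Nat.doubleFactorial (2 * k - 1) : ℂ) * (-Complex.I) ^ (k + 1) / (Real.pi : ℂ) ^ (k + 1)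

lemma Q_eq (N : ℕ) (x : ℝ) : Q N x = (1 + Complex.I) / 2 +
    ∑ k ∈ Finset.range (N + 1),
      Complex.exp (Complex.I * Real.pi * (x : ℂ) ^ 2 / 2) * (coeff k * ((x : ℂ) ^ (2 * k + 1))⁻¹) := by
  rw [Q, Finset.mul_sum]
  congr 1
  refine Finset.sum_congr rfl fun k _ => ?_
  rw [coeff, ← div_div, div_eq_mul_inv _ ((x : ℂ) ^ (2 * k + 1))]

/-- This recurrence lets the derivatives of consecutive terms of Q cancel. -/
lemma coeff_succ (k : ℕ) : Complex.I * Real.pi * coeff (k + 1) = (2 * k + 1) * coeff k := by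
  have hpC : (Real.pi : ℂ) ≠ 0 := by exact_mod_cast Real.pi_ne_zero
  have h : Nat.doubleFactorial (2 * (k + 1) - 1) = (2 * k + 1) * Nat.doubleFactorial (2 * k - 1) := by
    cases k with
    | zero => rfl
    | succ n => exact Nat.doubleFactorial_add_two (2 * n + 1)
  rw [coeff, coeff, h, pow_succ (-Complex.I) (k + 1)]
  push_cast
  field_simp
  linear_combination (-(2 * k + 1) * Real.pi ^ (k + 2) *
    (Nat.doubleFactorial (2 * k - 1) : ℂ) : ℂ) * Complex.I_sq

lemma I_mul_pi_mul_coeff_zero : Complex.I * Real.pi * coeff 0 = 1 := by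
  have hpC : (Real.pi : ℂ) ≠ 0 := by exact_mod_cast Real.pi_ne_zero
  simp only [coeff]
  simp
  field_simp
  linear_combination -Complex.I_sq

lemma norm_coeff (k : ℕ) :
    ‖coeff k‖ = (Nat.doubleFactorial (2 * k - 1) : ℝ) / Real.pi ^ (k + 1) := by
  rw [coeff, norm_div, norm_mul, norm_pow, norm_pow, norm_neg, Complex.norm_I, one_pow, mul_one,
    Complex.norm_natCast, Complex.norm_real, Real.norm_of_nonneg Real.pi_pos.le]

lemma hasDerivAt_exp_mul_inv_pow (k : ℕ) {x : ℝ} (hx : x ≠ 0) :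
    HasDerivAt (fun t : ℝ => Complex.exp (Complex.I * Real.pi * (t : ℂ) ^ 2 / 2) *
        (coeff k * ((t : ℂ) ^ (2 * k + 1))⁻¹))
      (Complex.exp (Complex.I * Real.pi * (x : ℂ) ^ 2 / 2) *
        (Complex.I * Real.pi * coeff k * ((x : ℂ) ^ (2 * k))⁻¹ -
          (2 * k + 1) * coeff k * ((x : ℂ) ^ (2 * k + 2))⁻¹)) x := by
  have hxC : (x : ℂ) ≠ 0 := by exact_mod_cast hx
  have h1 : HasDerivAt (fun z : ℂ => Complex.exp (Complex.I * Real.pi * z ^ 2 / 2))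
      (Complex.exp (Complex.I * Real.pi * (x : ℂ) ^ 2 / 2) * (Complex.I * Real.pi * x)) (x : ℂ) := by
    refine ((((hasDerivAt_pow 2 (x : ℂ)).const_mul (Complex.I * Real.pi)).div_const 2).cexp).congr_deriv ?_
    push_cast; ring
  have h2 := ((hasDerivAt_pow (2 * k + 1) (x : ℂ)).inv (pow_ne_zero _ hxC)).const_mul (coeff k)
  refine (h1.mul h2).comp_ofReal.congr_deriv ?_
  simp only [Pi.inv_apply]
  push_cast
  field_simp
  ring

lemma hasDerivAt_Q (N : ℕ) {x : ℝ} (hx : x ≠ 0) :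
    HasDerivAt (Q N) (Complex.exp (Complex.I * Real.pi * (x : ℂ) ^ 2 / 2) *
      (1 - (2 * N + 1) * coeff N * ((x : ℂ) ^ (2 * N + 2))⁻¹)) x := by
  rw [funext (Q_eq N)]
  refine HasDerivAt.const_add _ ?_
  induction N with
  | zero =>
    simp only [zero_add, Finset.sum_range_one]
    refine (hasDerivAt_exp_mul_inv_pow 0 hx).congr_deriv ?_
    rw [I_mul_pi_mul_coeff_zero]; simp
  | succ N ih =>
    simp only [Finset.sum_range_succ _ (N + 1)]
    refine (ih.add (hasDerivAt_exp_mul_inv_pow (N + 1) hx)).congr_deriv ?_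
    rw [coeff_succ]; push_cast; ring_nf

lemma tendsto_Q (N : ℕ) : Tendsto (Q N) atTop (𝓝 ((1 + Complex.I) / 2)) := by
  rw [funext (Q_eq N)]
  conv => rhs; rw [← add_zero ((1 + Complex.I) / 2 : ℂ)]
  refine tendsto_const_nhds.add ?_
  have h0 : (0 : ℂ) = ∑ _k ∈ Finset.range (N + 1), (0 : ℂ) := Finset.sum_const_zero.symm
  conv => rhs; rw [h0]
  refine tendsto_finsetSum _ fun k _ => ?_
  rw [tendsto_zero_iff_norm_tendsto_zero]
  simp_rw [norm_mul, norm_exp_I_pi_sq, one_mul, norm_inv, norm_pow, Complex.norm_real,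
    Real.norm_eq_abs]
  rw [← mul_zero ‖coeff k‖]
  exact (tendsto_inv_atTop_zero.comp
    ((tendsto_pow_atTop (by omega)).comp tendsto_abs_atTop_atTop)).const_mul _

/-- The error of the asymptotic expansion is at most the last retained term. -/
lemma norm_Q_sub_G_le (N : ℕ) {x : ℝ} (hx : 0 < x) :
    ‖Q N x - G x‖ ≤ ‖coeff N‖ * (x ^ (2 * N + 1))⁻¹ := by
  set D : ℝ → ℂ := fun t => Q N t - G t with hD
  have hD' : ∀ t : ℝ, 0 < t → HasDerivAt D (-(Complex.exp (Complex.I * Real.pi * (t : ℂ) ^ 2 / 2) *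
      ((2 * N + 1) * coeff N * ((t : ℂ) ^ (2 * N + 2))⁻¹))) t := fun t ht =>
    ((hasDerivAt_Q N ht.ne').sub (hasDerivAt_G t)).congr_deriv (by ring)
  -- A real comparison function, zero at t = x, whose derivative is exactly the norm of D'.
  have hB : ∀ t : ℝ, 0 < t → HasDerivAt
      (fun t => ‖coeff N‖ * ((x ^ (2 * N + 1))⁻¹ - (t ^ (2 * N + 1))⁻¹))
      (‖coeff N‖ * ((2 * N + 1) * (t ^ (2 * N + 2))⁻¹)) t := fun t ht => by
    have := (((hasDerivAt_pow (2 * N + 1) t).inv (pow_ne_zero _ ht.ne')).const_sub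
      ((x ^ (2 * N + 1))⁻¹)).const_mul ‖coeff N‖
    refine this.congr_deriv ?_
    push_cast
    field_simp
    ring
  have hstep : ∀ M, x ≤ M → ‖D M - D x‖ ≤ ‖coeff N‖ * (x ^ (2 * N + 1))⁻¹ := by
    intro M hM
    have hpos : ∀ t ∈ Set.Icc x M, 0 < t := fun t ht => hx.trans_le ht.1
    have h := image_norm_le_of_norm_deriv_right_le_deriv_boundary' (f := fun t => D t - D x)
      (a := x) (b := M)
      (fun t ht => ((hD' t (hpos t ht)).sub_const (D x)).continuousAt.continuousWithinAt)
      (fun t ht => ((hD' t (hpos t ⟨ht.1, ht.2.le⟩)).sub_const (D x)).hasDerivWithinAt)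
      (B := fun t => ‖coeff N‖ * ((x ^ (2 * N + 1))⁻¹ - (t ^ (2 * N + 1))⁻¹)) (by simp)
      (fun t ht => (hB t (hpos t ht)).continuousAt.continuousWithinAt)
      (fun t ht => (hB t (hpos t ⟨ht.1, ht.2.le⟩)).hasDerivWithinAt)
      (fun t ht => ?_) (Set.right_mem_Icc.2 hM)
    · refine h.trans (mul_le_mul_of_nonneg_left ?_ (norm_nonneg _))
      have : 0 < (M ^ (2 * N + 1))⁻¹ := by have := hx.trans_le hM; positivity
      linarith
    · have ht0 := hpos t ⟨ht.1, ht.2.le⟩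
      have h2 : ‖(2 * (N : ℂ) + 1)‖ = 2 * N + 1 := by
        rw [show (2 * (N : ℂ) + 1) = ((2 * N + 1 : ℕ) : ℂ) by push_cast; ring, Complex.norm_natCast]
        push_cast; ring
      rw [norm_neg, norm_mul, norm_exp_I_pi_sq, norm_mul, norm_mul, norm_inv, norm_pow,
        Complex.norm_real, Real.norm_of_nonneg ht0.le, h2]
      exact le_of_eq (by ring)
  -- Both Q and G tend to (1+i)/2, so D vanishes at infinity and the bound on D M - D x passes to D
  -- x.
  have hlim : Tendsto (fun M => ‖D M - D x‖) atTop (𝓝 ‖0 - D x‖) := by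
    refine Tendsto.norm (Tendsto.sub_const ?_ _)
    have := (tendsto_Q N).sub tendsto_G
    rwa [sub_self] at this
  rw [zero_sub, norm_neg] at hlim
  exact le_of_tendsto hlim ((eventually_ge_atTop x).mono hstep)

/-- The error of the asymptotic expansion is at most twice the first omitted term. -/
lemma norm_G_sub_Q_le (N : ℕ) {x : ℝ} (hx : 0 < x) :
    ‖G x - Q N x‖ ≤ 2 * (‖coeff (N + 1)‖ * (x ^ (2 * N + 3))⁻¹) := by
  have h1 := norm_Q_sub_G_le (N + 1) hx
  have h2 : Q (N + 1) x - Q N x = Complex.exp (Complex.I * Real.pi * (x : ℂ) ^ 2 / 2) *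
      (coeff (N + 1) * ((x : ℂ) ^ (2 * (N + 1) + 1))⁻¹) := by
    rw [Q_eq, Q_eq, Finset.sum_range_succ _ (N + 1)]; ring
  have h3 : ‖Q (N + 1) x - Q N x‖ = ‖coeff (N + 1)‖ * (x ^ (2 * (N + 1) + 1))⁻¹ := by
    rw [h2, norm_mul, norm_exp_I_pi_sq, one_mul, norm_mul, norm_inv, norm_pow, Complex.norm_real,
      Real.norm_of_nonneg hx.le]
  have e : G x - Q N x = (Q (N + 1) x - Q N x) - (Q (N + 1) x - G x) := by ring
  rw [e]
  refine (norm_sub_le _ _).trans ?_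
  rw [h3, show 2 * N + 3 = 2 * (N + 1) + 1 by ring]
  linarith

lemma norm_G_sub_Q_twelve_lt {x : ℝ} (hx : 6.725 ≤ x) : ‖G x - Q 12 x‖ < (2 : ℝ) ^ (-52 : ℤ) := by
  have hx0 : 0 < x := by linarith
  refine (norm_G_sub_Q_le 12 hx0).trans_lt ?_
  rw [norm_coeff]
  have hpi := Real.pi_gt_d2
  have hd : Nat.doubleFactorial (2 * (12 + 1) - 1) = 7905853580625 := by decide +kernel
  rw [hd]
  -- Here 25!! = 7905853580625; the value is about 0.8·10⁻¹⁶, against 2⁻⁵² ≈ 2.22·10⁻¹⁶.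
  calc _ ≤ 2 * (((7905853580625 : ℕ) : ℝ) / 3.14 ^ (12 + 1 + 1) * ((6.725 : ℝ) ^ (2 * 12 + 3))⁻¹) := by
        gcongr
    _ < (2 : ℝ) ^ (-52 : ℤ) := by norm_num

/-! ### The Taylor polynomial -/

lemma T_eq_integral (N : ℕ) (x : ℝ) :
    T N x = ∫ t in (0 : ℝ)..x, ∑ k ∈ Finset.range (N + 1),
      (Complex.I * Real.pi * (t : ℂ) ^ 2 / 2) ^ k / (Nat.factorial k : ℂ) := by
  rw [intervalIntegral.integral_finsetSum fun k _ =>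
    Continuous.intervalIntegrable (by fun_prop) _ _, T]
  refine Finset.sum_congr rfl fun k _ => ?_
  have h : ∀ t : ℝ, (Complex.I * Real.pi * (t : ℂ) ^ 2 / 2) ^ k / (Nat.factorial k : ℂ) =
      (Complex.I * Real.pi / 2) ^ k / (Nat.factorial k : ℂ) * ((t ^ (2 * k) : ℝ) : ℂ) := fun t => by
    push_cast; rw [pow_mul]; ring
  simp_rw [h]
  rw [intervalIntegral.integral_const_mul, intervalIntegral.integral_ofReal, integral_pow]
  have h1 : (2 * (k : ℂ) + 1) ≠ 0 := by
    rw [show (2 * (k : ℂ) + 1) = ((2 * k + 1 : ℕ) : ℂ) by push_cast; ring]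
    exact Nat.cast_ne_zero.2 (by omega)
  have h2 : (Nat.factorial k : ℂ) ≠ 0 := Nat.cast_ne_zero.2 (Nat.factorial_ne_zero k)
  push_cast
  rw [div_pow, zero_pow (by omega), sub_zero]
  field_simp

/-- The remainder bound `Complex.exp_bound` needs an argument of norm at most 1, whence `hx1`; it is
then integrated over t. -/
lemma norm_G_sub_T_le (N : ℕ) {x : ℝ} (hx : 0 ≤ x) (hx1 : Real.pi * x ^ 2 / 2 ≤ 1) :
    ‖G x - T N x‖ ≤ (Real.pi / 2) ^ (N + 1) * ((N + 1).succ * ((N + 1).factorial * (N + 1 : ℕ) : ℝ)⁻¹) *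
      (x ^ (2 * N + 3) / (2 * N + 3)) := by
  rw [G_eq_integral_exp, T_eq_integral, ← intervalIntegral.integral_sub
    (Continuous.intervalIntegrable (by fun_prop) _ _)
    (Continuous.intervalIntegrable (by fun_prop) _ _)]
  have hb : ∀ t ∈ Set.Ioc 0 x, ‖Complex.exp (Complex.I * Real.pi * (t : ℂ) ^ 2 / 2) -
      ∑ k ∈ Finset.range (N + 1), (Complex.I * Real.pi * (t : ℂ) ^ 2 / 2) ^ k /
        (Nat.factorial k : ℂ)‖ ≤ (Real.pi / 2) ^ (N + 1) *
          ((N + 1).succ * ((N + 1).factorial * (N + 1 : ℕ) : ℝ)⁻¹) * t ^ (2 * N + 2) := by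
    intro t ht
    have hn : ‖Complex.I * Real.pi * (t : ℂ) ^ 2 / 2‖ = Real.pi * t ^ 2 / 2 := by
      rw [norm_div, norm_mul, norm_mul, Complex.norm_I, norm_pow, Complex.norm_real,
        Complex.norm_real, Real.norm_of_nonneg Real.pi_pos.le, Real.norm_of_nonneg ht.1.le,
        Complex.norm_ofNat, one_mul]
    have hle : Real.pi * t ^ 2 / 2 ≤ 1 := by
      refine le_trans ?_ hx1
      have := ht.1.le
      have := ht.2
      have := Real.pi_pos
      gcongr
    refine (Complex.exp_bound (by rw [hn]; exact hle) N.succ_pos).trans (le_of_eq ?_)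
    rw [hn, show 2 * N + 2 = 2 * (N + 1) by ring, pow_mul, Nat.succ_eq_add_one N]
    ring
  refine (intervalIntegral.norm_integral_le_of_norm_le hx (Eventually.of_forall hb)
    (Continuous.intervalIntegrable (by fun_prop) _ _)).trans (le_of_eq ?_)
  rw [intervalIntegral.integral_const_mul, integral_pow, zero_pow (by omega), sub_zero]
  push_cast
  ring_nf

lemma norm_G_sub_T_fourteen_lt {x : ℝ} (hx : 0 ≤ x) (hx1 : x ≤ 0.688) :
    ‖G x - T 14 x‖ < (2 : ℝ) ^ (-52 : ℤ) := by
  have hpi := Real.pi_lt_d4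
  have hpi0 := Real.pi_pos
  have h : Real.pi * x ^ 2 / 2 ≤ 1 := by
    calc Real.pi * x ^ 2 / 2 ≤ 3.1416 * 0.688 ^ 2 / 2 := by gcongr
      _ ≤ 1 := by norm_num
  refine (norm_G_sub_T_le 14 hx h).trans_lt ?_
  have hf : Nat.factorial (14 + 1) = 1307674368000 := by decide +kernel
  rw [hf]
  -- The value is about 2.12·10⁻¹⁶, so 0.688 is nearly the largest breakpoint this bound allows.
  calc _ ≤ (3.1416 / 2) ^ (14 + 1) * (((14 + 1).succ : ℕ) *
        (((1307674368000 : ℕ) : ℝ) * ((14 + 1 : ℕ) : ℝ))⁻¹) *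
          ((0.688 : ℝ) ^ (2 * 14 + 3) / (2 * (14 : ℕ) + 3)) := by
        gcongr
    _ < (2 : ℝ) ^ (-52 : ℤ) := by norm_num

/-! ### Truncation of the trapezoid rule -/

lemma sum_Icc_eq_sum_gaussTerm (N : ℕ) (x : ℝ) :
    ∑ k ∈ Finset.Icc 1 N,
        Complex.exp (-(Real.pi : ℂ) * ((k : ℂ) - 1 / 2) ^ 2 / (A N : ℂ) ^ 2) /
          ((x : ℂ) ^ 2 + Complex.I * 2 * ((k : ℂ) - 1 / 2) ^ 2 / (A N : ℂ) ^ 2) =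
      ∑ n ∈ Finset.range N, gaussTerm (A N) x n := by
  rw [Finset.range_eq_Ico, ← Finset.Ico_add_one_right_eq_Icc,
    Finset.sum_Ico_add' (fun k : ℕ => Complex.exp (-(Real.pi : ℂ) * ((k : ℂ) - 1 / 2) ^ 2 / (A N : ℂ) ^ 2) /
          ((x : ℂ) ^ 2 + Complex.I * 2 * ((k : ℂ) - 1 / 2) ^ 2 / (A N : ℂ) ^ 2)) 0 N 1 |>.symm]
  refine Finset.sum_congr rfl fun n _ => ?_
  rw [gaussTerm, den]
  push_cast
  rw [show ((n : ℂ) + 1 - 1 / 2) = n + 1 / 2 by ring]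

lemma A_sq (N : ℕ) : A N ^ 2 = N + 1 / 2 := Real.sq_sqrt (by positivity)

lemma A_pos (N : ℕ) : 0 < A N := Real.sqrt_pos.2 (by positivity)

/-- The truncation error of the Gaussian sum. -/
lemma norm_tsum_gaussTerm_sub_sum_le (N : ℕ) {x : ℝ} (hx : 0 < x) :
    ‖∑' n, gaussTerm (A N) x n - ∑ n ∈ Finset.range N, gaussTerm (A N) x n‖ ≤
      Real.exp (-Real.pi * (N + 1 / 2)) * (1 - Real.exp (-Real.pi))⁻¹ / (2 * N + 1) := by
  have hq1 : Real.exp (-Real.pi) < 1 := Real.exp_lt_one_iff.2 (by linarith [Real.pi_pos])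
  have hA := A_sq N
  rw [← (summable_gaussTerm (A_pos N) hx).sum_add_tsum_nat_add N, add_sub_cancel_left]
  refine tsum_of_norm_bounded (((hasSum_geometric_of_lt_one (Real.exp_pos _).le hq1).mul_left
    (Real.exp (-Real.pi * (N + 1 / 2)))).div_const (2 * N + 1)) fun n => ?_
  rw [norm_gaussTerm]
  have hN : (0 : ℝ) < N + 1 / 2 := by positivity
  have hd : (2 * (N : ℝ) + 1) ≤ ‖den (A N) x (n + N)‖ := by
    refine le_trans ?_ (two_mul_half_sq_div_le_norm_den (A N) x (n + N))
    rw [hA, le_div_iff₀ hN]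
    push_cast
    nlinarith [(Nat.cast_nonneg n : (0 : ℝ) ≤ n), (Nat.cast_nonneg N : (0 : ℝ) ≤ N)]
  gcongr
  rw [← Real.exp_nat_mul, ← Real.exp_add]
  apply Real.exp_le_exp.2
  rw [hA, div_le_iff₀ hN]
  push_cast
  -- After division by A² = N + 1/2, the exponent of term n + N is at most -π(N + 1/2) - πn, which
  -- gives a geometric tail.
  have h1 : ((N : ℝ) + 1 / 2 + n) * (N + 1 / 2) ≤ (n + N + 1 / 2) ^ 2 := by
    nlinarith [(Nat.cast_nonneg n : (0 : ℝ) ≤ n), (Nat.cast_nonneg N : (0 : ℝ) ≤ N)]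
  nlinarith [mul_le_mul_of_nonneg_left h1 Real.pi_pos.le]

/-- Discretization plus truncation; the choice A² = N + 1/2 gives both the same exponential factor.
-/
lemma norm_G_sub_trapezoid_le (N : ℕ) {x : ℝ} (hx : 0 < x) :
    ‖G x - trapezoid N x‖ ≤
      x * (2 * (Real.exp (-Real.pi * (N + 1 / 2)) / (1 - Real.exp (-Real.pi * (N + 1 / 2))))) +
      2 * x / (Real.pi * A N) *
        (Real.exp (-Real.pi * (N + 1 / 2)) * (1 - Real.exp (-Real.pi))⁻¹ / (2 * N + 1)) := by
  have h1 := norm_G_sub_trapezoid_infinite_le (A_pos N) hx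
  have h2 := norm_tsum_gaussTerm_sub_sum_le N hx
  rw [A_sq] at h1
  rw [trapezoid, sum_Icc_eq_sum_gaussTerm]
  set P := (1 + Complex.I) / 2
        - (1 + Complex.I) / (Complex.exp ((1 - Complex.I) * Real.pi * (A N) * x) + 1)
  set R := 2 * Complex.I * x * Complex.exp (Complex.I * Real.pi * (x : ℂ) ^ 2 / 2) /
    (Real.pi * A N) with hR
  have hRn : ‖R‖ = 2 * x / (Real.pi * A N) := by
    rw [hR, norm_div, norm_mul, norm_exp_I_pi_sq, norm_mul, norm_mul, norm_mul,
      Complex.norm_I, Complex.norm_real, Complex.norm_real, Complex.norm_real,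
      Real.norm_of_nonneg hx.le, Real.norm_of_nonneg Real.pi_pos.le,
      Real.norm_of_nonneg (A_pos N).le, Complex.norm_ofNat, mul_one, mul_one]
  have e : G x - (P - R * ∑ n ∈ Finset.range N, gaussTerm (A N) x n) =
      (G x - (P - R * ∑' n, gaussTerm (A N) x n)) -
        R * (∑' n, gaussTerm (A N) x n - ∑ n ∈ Finset.range N, gaussTerm (A N) x n) := by ring
  rw [e]
  refine (norm_sub_le _ _).trans (add_le_add h1 ?_)
  rw [norm_mul, hRn]
  exact mul_le_mul_of_nonneg_left h2 (by have := A_pos N; have := Real.pi_pos; positivity)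

lemma norm_G_sub_trapezoid_twelve_lt {x : ℝ} (hx : 0 < x) (hx1 : x ≤ 6.725) :
    ‖G x - trapezoid 12 x‖ < (2 : ℝ) ^ (-52 : ℤ) := by
  refine (norm_G_sub_trapezoid_le 12 hx).trans_lt ?_
  have hpi := Real.pi_gt_d2
  have hq : Real.exp (-Real.pi * ((12 : ℕ) + 1 / 2)) ≤ (12 / 10 ^ 18) := by
    -- 3.14 · 12.5 = 39.25 exceeds 39.
    have h1 : Real.exp (-Real.pi * ((12 : ℕ) + 1 / 2)) ≤ Real.exp (-(39 : ℕ)) := by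
      apply Real.exp_le_exp.2; push_cast; linarith
    refine h1.trans ?_
    rw [Real.exp_neg, ← mul_one ((39 : ℕ) : ℝ), Real.exp_nat_mul]
    have he := Real.exp_one_gt_d9
    calc (Real.exp 1 ^ 39)⁻¹ ≤ ((2.718 : ℝ) ^ 39)⁻¹ := by gcongr; linarith
      _ ≤ (12 / 10 ^ 18) := by norm_num
  have hp : Real.exp (-Real.pi) ≤ 1 / 2 := by
    rw [Real.exp_neg, inv_le_comm₀ (Real.exp_pos _) (by norm_num)]
    linarith [Real.add_one_le_exp Real.pi]
  have hA : 3 ≤ A 12 := Real.le_sqrt_of_sq_le (by norm_num)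
  have hq0 := Real.exp_pos (-Real.pi * ((12 : ℕ) + 1 / 2))
  set q := Real.exp (-Real.pi * ((12 : ℕ) + 1 / 2))
  have h3 : 3 ≤ Real.pi := by linarith
  have h1q : 0 < 1 - q := by norm_num at hq; linarith
  have hq2 : 0 ≤ q / (1 - q) := by positivity
  have h1p : 0 < 1 - Real.exp (-Real.pi) := by linarith
  have hp2 : 0 ≤ (1 - Real.exp (-Real.pi))⁻¹ := by positivity
  -- The first summand is about 1.61·10⁻¹⁶, the second about 10⁻¹⁸.
  calc _ ≤ (6.725 : ℝ) * (2 * ((12 / 10 ^ 18) / (1 - (12 / 10 ^ 18)))) +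
        2 * 6.725 / (3 * 3) * ((12 / 10 ^ 18) * (1 - 1 / 2)⁻¹ / (2 * ((12 : ℕ) : ℝ) + 1)) := by
        gcongr
    _ < (2 : ℝ) ^ (-52 : ℤ) := by norm_num

/-! ### The three ranges and odd symmetry -/

lemma norm_G_sub_approxNonneg_lt {x : ℝ} (hx : 0 ≤ x) :
    ‖G x - approxNonneg x‖ < (2 : ℝ) ^ (-52 : ℤ) := by
  rw [approxNonneg]
  split_ifs with h1 h2
  · exact norm_G_sub_T_fourteen_lt hx h1
  · exact norm_G_sub_trapezoid_twelve_lt (by norm_num at h1; linarith) h2.le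
  · exact norm_G_sub_Q_twelve_lt (not_lt.1 h2)

end Fresnel

theorem mainTheorem3 :
    ∀ x : ℝ, ‖Fresnel.G x - Fresnel.Gtilde x‖ < (2 : ℝ) ^ (-52 : ℤ) := by
  intro x
  rw [Fresnel.Gtilde]
  split_ifs with h
  · exact Fresnel.norm_G_sub_approxNonneg_lt h
  · have h1 := Fresnel.norm_G_sub_approxNonneg_lt (x := -x) (by linarith)
    rwa [Fresnel.G_neg, ← neg_add', norm_neg, ← sub_neg_eq_add] at h1
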